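/- **Setting.** An *order-type* over $n\in\mathbb N$ is a tuple $\varepsilon\in\{1,\partial\}^n$; let $1^\partial=\partial$ and $\partial^\partial=1$. An *LE-signature* consists of two disjoint sets $\mathcal F,\mathcal G$ of connectives, each $h\in\mathcal F\cup\mathcal G$ having an arity $n_h\in\mathbb N$ and an order-type $\varepsilon_h$ over $n_h$. Fix a denumerable set $\mathsf{AtProp}$ of proposition letters. The formulas of $\mathcal L_{\mathrm{LE}}(\mathcal F,\mathcal G)$ are $$\varphi::=p\mid\bot\mid\top\mid\varphi\wedge\varphi\mid\varphi\vee\varphi\mid f(\varphi_1,\dots,\varphi_{n_f})\mid g(\varphi_1,\dots,\varphi_{n_g})\qquad(p\in\mathsf{AtProp},\ f\in\mathcal F,\ g\in\mathcal G).$$ A sequent is a pair $\varphi\vdash\psi$ of formulas. For a connective $h$ and a coordinate $i$ write $h[\varphi]_i$ for $h(p_1,\dots,\varphi,\dots,p_{n_h})$ with $\varphi$ in the $i$-th place and proposition letters elsewhere (the same ones throughout an axiom or rule). **The basic LE-logic** $\mathbb L_{\mathrm{LE}}(\mathcal F,\mathcal G)$ is the least set of sequents that contains, for all letters $p,q$ (and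 all letters in the other places), the axioms * $p\vdash p$, $\ \bot\vdash p$, $\ p\vdash\top$, $\ p\vdash p\vee q$, $\ q\vdash p\vee q$, $\ p\wedge q\vdash p$, $\ p\wedge q\vdash q$; * $f[\bot]_i\vdash\bot$ and $f[p\vee q]_i\vdash f[p]_i\vee f[q]_i$ if $\varepsilon_f(i)=1$; $\ f[\top]_i\vdash\bot$ and $f[p\wedge q]_i\vdash f[p]_i\vee f[q]_i$ if $\varepsilon_f(i)=\partial$; * $\top\vdash g[\top]_i$ and $g[p]_i\wedge g[q]_i\vdash g[p\wedge q]_i$ if $\varepsilon_g(i)=1$; $\ \top\vdash g[\bot]_i$ and $g[p]_i\wedge g[q]_i\vdash g[p\vee q]_i$ if $\varepsilon_g(i)=\partial$; and is closed under the following rules: * from $\varphi\vdash\chi$ and $\chi\vdash\psi$ infer $\varphi\vdash\psi$; * from $\varphi\vdash\psi$ infer $\varphi(\chi/p)\vdash\psi(\chi/p)$, for every formula $\chi$ and letter $p$; * from $\chi\vdash\varphi$ and $\chi\vdash\psi$ infer $\chi\vdash\varphi\wedge\psi$; from $\varphi\vdash\chi$ and $\psi\vdash\chi$ infer $\varphi\vee\psi\vdash\chi$;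 * for $h\in\mathcal F\cup\mathcal G$, from $\varphi\vdash\psi$ infer $h[\varphi]_i\vdash h[\psi]_i$ if $\varepsilon_h(i)=1$, and $h[\psi]_i\vdash h[\varphi]_i$ if $\varepsilon_h(i)=\partial$. **The tense language** $\mathcal L^*_{\mathrm{LE}}=\mathcal L_{\mathrm{LE}}(\mathcal F^*,\mathcal G^*)$ is obtained by adding, for each $f\in\mathcal F$ and $1\le i\le n_f$, an $n_f$-ary connective $f^\sharp_i$, and for each $g\in\mathcal G$ and $1\le i\le n_g$, an $n_g$-ary connective $g^\flat_i$. Here $f^\sharp_i\in\mathcal G^*$ if $\varepsilon_f(i)=1$ and $f^\sharp_i\in\mathcal F^*$ if $\varepsilon_f(i)=\partial$; $g^\flat_i\in\mathcal F^*$ if $\varepsilon_g(i)=1$ and $g^\flat_i\in\mathcal G^*$ if $\varepsilon_g(i)=\partial$. If $k$ is the connective so added for $h\in\mathcal F\cup\mathcal G$ and $i$, then $\varepsilon_k(i)=\varepsilon_h(i)$ and, for $j\ne i$, $\varepsilon_k(j)=\varepsilon_h(j)^\partial$ if $\varepsilon_h(i)=1$, and $\varepsilon_k(j)=\varepsilon_h(j)$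 if $\varepsilon_h(i)=\partial$. **The basic tense logic** $\mathbb L^*_{\mathrm{LE}}$ is the least set of $\mathcal L^*_{\mathrm{LE}}$-sequents that contains the above axioms and is closed under the above rules, taken for the signature $(\mathcal F^*,\mathcal G^*)$, and is moreover closed, in both directions, under the following rules, for $f\in\mathcal F$, $g\in\mathcal G$ and arbitrary $\mathcal L^*_{\mathrm{LE}}$-formulas (the $i$-th argument is displayed, the others are the same on both sides): * $f(\varphi_1,\dots,\varphi,\dots,\varphi_{n_f})\vdash\psi$ iff $\varphi\vdash f^\sharp_i(\varphi_1,\dots,\psi,\dots,\varphi_{n_f})$, if $\varepsilon_f(i)=1$; * $f(\varphi_1,\dots,\varphi,\dots,\varphi_{n_f})\vdash\psi$ iff $f^\sharp_i(\varphi_1,\dots,\psi,\dots,\varphi_{n_f})\vdash\varphi$, if $\varepsilon_f(i)=\partial$; * $\varphi\vdash g(\varphi_1,\dots,\psi,\dots,\varphi_{n_g})$ iff $g^\flat_i(\varphi_1,\dots,\varphi,\dots,\varphi_{n_g})\vdash\psi$, if $\varepsilon_g(i)=1$; * $\varphi\vdash g(\varphi_1,\dots,\psi,\dots,\varphi_{n_g})$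 iff $\psi\vdash g^\flat_i(\varphi_1,\dots,\varphi,\dots,\varphi_{n_g})$, if $\varepsilon_g(i)=\partial$. **Theorem.** For every LE-signature $(\mathcal F,\mathcal G)$, the logic $\mathbb L^*_{\mathrm{LE}}$ is a conservative extension of $\mathbb L_{\mathrm{LE}}$: every $\mathcal L_{\mathrm{LE}}$-sequent $\varphi\vdash\psi$ is derivable in $\mathbb L_{\mathrm{LE}}$ if and only if it is derivable in $\mathbb L^*_{\mathrm{LE}}$. -/

import Mathlib

universe u v w

namespace LELogic

/-- The two entries `1` and `∂` of an order-type. -/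
inductive Sgn : Type
  | one : Sgn
  | del : Sgn

/-- The opposite entry: `1` and `∂` are swapped. -/
def Sgn.opp : Sgn → Sgn
  | Sgn.one => Sgn.del
  | Sgn.del => Sgn.one

/-- An order-type over `n`. -/
abbrev OrderType (n : ℕ) : Type := Fin n → Sgn

/-- An LE-signature: two (automatically disjoint) sets of connectives `F` and `G`, each connective
having a finite arity and an order-type over that arity. -/
structure Signature : Type (max (u + 1) (v + 1)) where
  F : Type u
  G : Type v
  arF : F → ℕ
  arG : G → ℕ
  ordF : (f : F) → OrderType (arF f)
  ordG : (g : G) → OrderType (arG g)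

/-- The formulas of the LE-language of signature `S` over the proposition letters `P`. -/
inductive Formula (S : Signature.{u, v}) (P : Type w) : Type (max u v w)
  | var (p : P) : Formula S P
  | bot : Formula S P
  | top : Formula S P
  | and (φ ψ : Formula S P) : Formula S P
  | or (φ ψ : Formula S P) : Formula S P
  | opF (f : S.F) (args : Fin (S.arF f) → Formula S P) : Formula S P
  | opG (g : S.G) (args : Fin (S.arG g) → Formula S P) : Formula S P

/-- Simultaneous substitution of formulas for proposition letters. -/
def Formula.subst {S : Signature.{u, v}} {P : Type w} (σ : P → Formula S P) :
    Formula S P → Formula S P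
  | .var p => σ p
  | .bot => .bot
  | .top => .top
  | .and φ ψ => .and (φ.subst σ) (ψ.subst σ)
  | .or φ ψ => .or (φ.subst σ) (ψ.subst σ)
  | .opF f args => .opF f (fun i => (args i).subst σ)
  | .opG g args => .opG g (fun i => (args i).subst σ)

/-- `φ.subst1 χ p` is `φ(χ/p)`: every occurrence of the letter `p` is replaced by `χ`. -/
def Formula.subst1 {S : Signature.{u, v}} {P : Type w} [DecidableEq P]
    (φ χ : Formula S P) (p : P) : Formula S P :=
  φ.subst (Function.update Formula.var p χ)

/-- `f(p₁, …, φ, …, pₙ)`: the connective `f` applied to proposition letters, except that the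
`i`-th argument is `φ`. -/
def Formula.atF {S : Signature.{u, v}} {P : Type w} (f : S.F) (a : Fin (S.arF f) → P)
    (i : Fin (S.arF f)) (φ : Formula S P) : Formula S P :=
  .opF f (Function.update (fun j => Formula.var (a j)) i φ)

/-- `g(p₁, …, φ, …, pₙ)`: the connective `g` applied to proposition letters, except that the
`i`-th argument is `φ`. -/
def Formula.atG {S : Signature.{u, v}} {P : Type w} (g : S.G) (a : Fin (S.arG g) → P)
    (i : Fin (S.arG g)) (φ : Formula S P) : Formula S P :=
  .opG g (Function.update (fun j => Formula.var (a j)) i φ)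

/-- A sequent `lhs ⊢ rhs`. -/
structure Sequent (S : Signature.{u, v}) (P : Type w) : Type (max u v w) where
  lhs : Formula S P
  rhs : Formula S P

open Formula in
/-- The least set of sequents that contains the axioms of the basic LE-logic of signature `S` and
is closed under its inference rules and under the additional unary rules in `R`, where `R s t`
means that `t` may be inferred from `s`. -/
inductive Derivable (S : Signature.{u, v}) (P : Type w) [DecidableEq P]
    (R : Sequent S P → Sequent S P → Prop) : Sequent S P → Prop
  -- lattice axioms
  | refl (p : P) : Derivable S P R ⟨var p, var p⟩
  | botLe (p : P) : Derivable S P R ⟨bot, var p⟩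
  | leTop (p : P) : Derivable S P R ⟨var p, top⟩
  | leOrLeft (p q : P) : Derivable S P R ⟨var p, or (var p) (var q)⟩
  | leOrRight (p q : P) : Derivable S P R ⟨var q, or (var p) (var q)⟩
  | andLeLeft (p q : P) : Derivable S P R ⟨and (var p) (var q), var p⟩
  | andLeRight (p q : P) : Derivable S P R ⟨and (var p) (var q), var q⟩
  -- axioms for the connectives
  | fBot (f : S.F) (a : Fin (S.arF f) → P) (i : Fin (S.arF f)) (hi : S.ordF f i = Sgn.one) :
      Derivable S P R ⟨atF f a i bot, bot⟩
  | fTop (f : S.F) (a : Fin (S.arF f) → P) (i : Fin (S.arF f)) (hi : S.ordF f i = Sgn.del) :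
      Derivable S P R ⟨atF f a i top, bot⟩
  | gTop (g : S.G) (a : Fin (S.arG g) → P) (i : Fin (S.arG g)) (hi : S.ordG g i = Sgn.one) :
      Derivable S P R ⟨top, atG g a i top⟩
  | gBot (g : S.G) (a : Fin (S.arG g) → P) (i : Fin (S.arG g)) (hi : S.ordG g i = Sgn.del) :
      Derivable S P R ⟨top, atG g a i bot⟩
  | fOr (f : S.F) (a : Fin (S.arF f) → P) (i : Fin (S.arF f)) (p q : P)
      (hi : S.ordF f i = Sgn.one) :
      Derivable S P R
        ⟨atF f a i (or (var p) (var q)), or (atF f a i (var p)) (atF f a i (var q))⟩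
  | fAnd (f : S.F) (a : Fin (S.arF f) → P) (i : Fin (S.arF f)) (p q : P)
      (hi : S.ordF f i = Sgn.del) :
      Derivable S P R
        ⟨atF f a i (and (var p) (var q)), or (atF f a i (var p)) (atF f a i (var q))⟩
  | gAnd (g : S.G) (a : Fin (S.arG g) → P) (i : Fin (S.arG g)) (p q : P)
      (hi : S.ordG g i = Sgn.one) :
      Derivable S P R
        ⟨and (atG g a i (var p)) (atG g a i (var q)), atG g a i (and (var p) (var q))⟩
  | gOr (g : S.G) (a : Fin (S.arG g) → P) (i : Fin (S.arG g)) (p q : P)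
      (hi : S.ordG g i = Sgn.del) :
      Derivable S P R
        ⟨and (atG g a i (var p)) (atG g a i (var q)), atG g a i (or (var p) (var q))⟩
  -- inference rules
  | cut (φ χ ψ : Formula S P) (h₁ : Derivable S P R ⟨φ, χ⟩) (h₂ : Derivable S P R ⟨χ, ψ⟩) :
      Derivable S P R ⟨φ, ψ⟩
  | substitution (φ ψ χ : Formula S P) (p : P) (h : Derivable S P R ⟨φ, ψ⟩) :
      Derivable S P R ⟨φ.subst1 χ p, ψ.subst1 χ p⟩
  | leAnd (χ φ ψ : Formula S P) (h₁ : Derivable S P R ⟨χ, φ⟩) (h₂ : Derivable S P R ⟨χ, ψ⟩) :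
      Derivable S P R ⟨χ, and φ ψ⟩
  | orLe (φ ψ χ : Formula S P) (h₁ : Derivable S P R ⟨φ, χ⟩) (h₂ : Derivable S P R ⟨ψ, χ⟩) :
      Derivable S P R ⟨or φ ψ, χ⟩
  | fMono (f : S.F) (a : Fin (S.arF f) → P) (i : Fin (S.arF f)) (φ ψ : Formula S P)
      (hi : S.ordF f i = Sgn.one) (h : Derivable S P R ⟨φ, ψ⟩) :
      Derivable S P R ⟨atF f a i φ, atF f a i ψ⟩
  | fAnti (f : S.F) (a : Fin (S.arF f) → P) (i : Fin (S.arF f)) (φ ψ : Formula S P)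
      (hi : S.ordF f i = Sgn.del) (h : Derivable S P R ⟨φ, ψ⟩) :
      Derivable S P R ⟨atF f a i ψ, atF f a i φ⟩
  | gMono (g : S.G) (a : Fin (S.arG g) → P) (i : Fin (S.arG g)) (φ ψ : Formula S P)
      (hi : S.ordG g i = Sgn.one) (h : Derivable S P R ⟨φ, ψ⟩) :
      Derivable S P R ⟨atG g a i φ, atG g a i ψ⟩
  | gAnti (g : S.G) (a : Fin (S.arG g) → P) (i : Fin (S.arG g)) (φ ψ : Formula S P)
      (hi : S.ordG g i = Sgn.del) (h : Derivable S P R ⟨φ, ψ⟩) :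
      Derivable S P R ⟨atG g a i ψ, atG g a i φ⟩
  -- additional rules
  | extra (s t : Sequent S P) (hR : R s t) (h : Derivable S P R s) : Derivable S P R t

/-- The basic (minimal) LE-logic of signature `S`. -/
def basicLogic (S : Signature.{u, v}) (P : Type w) [DecidableEq P] : Set (Sequent S P) :=
  {s | Derivable S P (fun _ _ => False) s}

/-- The connectives in `F*`: those of `F`, the Galois-adjoints `f♯ᵢ` of `f ∈ F` in the
coordinates `i` with `ε_f(i) = ∂`, and the left residuals `g♭ᵢ` of `g ∈ G` in the coordinates `i`
with `ε_g(i) = 1`. -/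
inductive FStar (S : Signature.{u, v}) : Type (max u v)
  | base (f : S.F) : FStar S
  | sharp (f : S.F) (i : Fin (S.arF f)) (hi : S.ordF f i = Sgn.del) : FStar S
  | flat (g : S.G) (i : Fin (S.arG g)) (hi : S.ordG g i = Sgn.one) : FStar S

/-- The connectives in `G*`: those of `G`, the right residuals `f♯ᵢ` of `f ∈ F` in the
coordinates `i` with `ε_f(i) = 1`, and the Galois-adjoints `g♭ᵢ` of `g ∈ G` in the coordinates `i`
with `ε_g(i) = ∂`. -/
inductive GStar (S : Signature.{u, v}) : Type (max u v)
  | base (g : S.G) : GStar S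
  | sharp (f : S.F) (i : Fin (S.arF f)) (hi : S.ordF f i = Sgn.one) : GStar S
  | flat (g : S.G) (i : Fin (S.arG g)) (hi : S.ordG g i = Sgn.del) : GStar S

/-- The order-type of the residual in coordinate `i` of a connective of order-type `ε`: it keeps
the entry at `i`, and its other entries are those of the opposite of `ε` if `ε i = 1`, and those of
`ε` itself if `ε i = ∂`. -/
def residualOrd {n : ℕ} (ε : OrderType n) (i : Fin n) : OrderType n := fun j =>
  if j = i then ε i
  else match ε i with
    | Sgn.one => (ε j).opp
    | Sgn.del => ε j

def FStar.arity {S : Signature.{u, v}} : FStar S → ℕ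
  | .base f => S.arF f
  | .sharp f _ _ => S.arF f
  | .flat g _ _ => S.arG g

def GStar.arity {S : Signature.{u, v}} : GStar S → ℕ
  | .base g => S.arG g
  | .sharp f _ _ => S.arF f
  | .flat g _ _ => S.arG g

def FStar.ord {S : Signature.{u, v}} : (k : FStar S) → OrderType k.arity
  | .base f => S.ordF f
  | .sharp f i _ => residualOrd (S.ordF f) i
  | .flat g i _ => residualOrd (S.ordG g) i

def GStar.ord {S : Signature.{u, v}} : (k : GStar S) → OrderType k.arity
  | .base g => S.ordG g
  | .sharp f i _ => residualOrd (S.ordF f) i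
  | .flat g i _ => residualOrd (S.ordG g) i

/-- The signature of the tense language associated with `S`. -/
def Signature.star (S : Signature.{u, v}) : Signature.{max u v, max u v} where
  F := FStar S
  G := GStar S
  arF := FStar.arity
  arG := GStar.arity
  ordF := FStar.ord
  ordG := GStar.ord

section Connectives

variable {S : Signature.{u, v}} {P : Type w}

/-- `f(φ₁, …, φₙ)` in the tense language, for `f ∈ F`. -/
def starF (f : S.F) (args : Fin (S.arF f) → Formula S.star P) : Formula S.star P :=
  .opF (S := S.star) (FStar.base f) args

/-- `g(φ₁, …, φₙ)` in the tense language, for `g ∈ G`. -/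
def starG (g : S.G) (args : Fin (S.arG g) → Formula S.star P) : Formula S.star P :=
  .opG (S := S.star) (GStar.base g) args

/-- `f♯ᵢ(φ₁, …, φₙ)` where `ε_f(i) = 1`. -/
def sharpOne (f : S.F) (i : Fin (S.arF f)) (hi : S.ordF f i = Sgn.one)
    (args : Fin (S.arF f) → Formula S.star P) : Formula S.star P :=
  .opG (S := S.star) (GStar.sharp f i hi) args

/-- `f♯ᵢ(φ₁, …, φₙ)` where `ε_f(i) = ∂`. -/
def sharpDel (f : S.F) (i : Fin (S.arF f)) (hi : S.ordF f i = Sgn.del)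
    (args : Fin (S.arF f) → Formula S.star P) : Formula S.star P :=
  .opF (S := S.star) (FStar.sharp f i hi) args

/-- `g♭ᵢ(φ₁, …, φₙ)` where `ε_g(i) = 1`. -/
def flatOne (g : S.G) (i : Fin (S.arG g)) (hi : S.ordG g i = Sgn.one)
    (args : Fin (S.arG g) → Formula S.star P) : Formula S.star P :=
  .opF (S := S.star) (FStar.flat g i hi) args

/-- `g♭ᵢ(φ₁, …, φₙ)` where `ε_g(i) = ∂`. -/
def flatDel (g : S.G) (i : Fin (S.arG g)) (hi : S.ordG g i = Sgn.del)
    (args : Fin (S.arG g) → Formula S.star P) : Formula S.star P :=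
  .opG (S := S.star) (GStar.flat g i hi) args

end Connectives

/-- The inclusion of the language of `S` into the tense language. -/
def Formula.toStar {S : Signature.{u, v}} {P : Type w} : Formula S P → Formula S.star P
  | .var p => .var p
  | .bot => .bot
  | .top => .top
  | .and φ ψ => .and φ.toStar ψ.toStar
  | .or φ ψ => .or φ.toStar ψ.toStar
  | .opF f args => starF f (fun i => (args i).toStar)
  | .opG g args => starG g (fun i => (args i).toStar)

def Sequent.toStar {S : Signature.{u, v}} {P : Type w} (s : Sequent S P) : Sequent S.star P :=
  ⟨s.lhs.toStar, s.rhs.toStar⟩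

open Function in
/-- The residuation rules of the tense logic. Each rule is invertible, hence is given by two
constructors: `…_down` infers the lower sequent from the upper one, `…_up` conversely. The tuple
`a` supplies the arguments in the coordinates other than `i`. -/
inductive ResiduationRule (S : Signature.{u, v}) (P : Type w) :
    Sequent S.star P → Sequent S.star P → Prop
  | fOne_down (f : S.F) (i : Fin (S.arF f)) (hi : S.ordF f i = Sgn.one)
      (a : Fin (S.arF f) → Formula S.star P) (φ ψ : Formula S.star P) :
      ResiduationRule S P ⟨starF f (update a i φ), ψ⟩ ⟨φ, sharpOne f i hi (update a i ψ)⟩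
  | fOne_up (f : S.F) (i : Fin (S.arF f)) (hi : S.ordF f i = Sgn.one)
      (a : Fin (S.arF f) → Formula S.star P) (φ ψ : Formula S.star P) :
      ResiduationRule S P ⟨φ, sharpOne f i hi (update a i ψ)⟩ ⟨starF f (update a i φ), ψ⟩
  | gOne_down (g : S.G) (i : Fin (S.arG g)) (hi : S.ordG g i = Sgn.one)
      (a : Fin (S.arG g) → Formula S.star P) (φ ψ : Formula S.star P) :
      ResiduationRule S P ⟨φ, starG g (update a i ψ)⟩ ⟨flatOne g i hi (update a i φ), ψ⟩
  | gOne_up (g : S.G) (i : Fin (S.arG g)) (hi : S.ordG g i = Sgn.one)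
      (a : Fin (S.arG g) → Formula S.star P) (φ ψ : Formula S.star P) :
      ResiduationRule S P ⟨flatOne g i hi (update a i φ), ψ⟩ ⟨φ, starG g (update a i ψ)⟩
  | fDel_down (f : S.F) (i : Fin (S.arF f)) (hi : S.ordF f i = Sgn.del)
      (a : Fin (S.arF f) → Formula S.star P) (φ ψ : Formula S.star P) :
      ResiduationRule S P ⟨starF f (update a i φ), ψ⟩ ⟨sharpDel f i hi (update a i ψ), φ⟩
  | fDel_up (f : S.F) (i : Fin (S.arF f)) (hi : S.ordF f i = Sgn.del)
      (a : Fin (S.arF f) → Formula S.star P) (φ ψ : Formula S.star P) :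
      ResiduationRule S P ⟨sharpDel f i hi (update a i ψ), φ⟩ ⟨starF f (update a i φ), ψ⟩
  | gDel_down (g : S.G) (i : Fin (S.arG g)) (hi : S.ordG g i = Sgn.del)
      (a : Fin (S.arG g) → Formula S.star P) (φ ψ : Formula S.star P) :
      ResiduationRule S P ⟨φ, starG g (update a i ψ)⟩ ⟨ψ, flatDel g i hi (update a i φ)⟩
  | gDel_up (g : S.G) (i : Fin (S.arG g)) (hi : S.ordG g i = Sgn.del)
      (a : Fin (S.arG g) → Formula S.star P) (φ ψ : Formula S.star P) :
      ResiduationRule S P ⟨ψ, flatDel g i hi (update a i φ)⟩ ⟨φ, starG g (update a i ψ)⟩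

/-- The basic tense logic associated with the signature `S`: the basic LE-logic of the tense
signature, closed in addition under the residuation rules. -/
def tenseLogic (S : Signature.{u, v}) (P : Type w) [DecidableEq P] : Set (Sequent S.star P) :=
  {s | Derivable S.star P (ResiduationRule S P) s}

end LELogic

/-!
The logic is sound for lattices whose operations are residuated in each coordinate, and such a
lattice also interprets the tense language: the residuals interpret the additional connectives and
satisfy the residuation rules. So a sequent of the original language that is derivable in the
tense logic holds in all of these lattices, and it suffices to find one in which only the sequents
derivable in the basic logic hold.

Preorder the formulas by derivability and take the canonical extension, the complete lattice of
concepts of the relation "`X` meets `Y`" between filters `X` and ideals `Y`. An operation that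
preserves or reverses finite joins (for `f ∈ F`) or meets (for `g ∈ G`) in each coordinate extends
to a residuated operation, because the sets that determine its values and its residuals are
automatically closed for the Galois connection of this relation. The formulas embed, the embedding
reflects the order, and the value of a formula under the canonical valuation is its image.
-/

namespace LELogic

open Function OrderDual

/-! ### Signed orders -/

/-- Multiplication of signs, with unit `1`: if the output of an operation is read with the sign `t`
and its `i`-th coordinate has the entry `s`, then its `i`-th input is read with the sign
`t.mul s`. -/
def Sgn.mul : Sgn → Sgn → Sgn
  | .one, s => s
  | .del, s => s.opp

@[simp]
theorem Sgn.opp_opp (s : Sgn) : s.opp.opp = s := by cases s <;> rfl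

/-- The order of `A` for the sign `1`, the reverse order for the sign `∂`. -/
def SignedLE {A : Type*} [LE A] : Sgn → A → A → Prop
  | .one, x, y => x ≤ y
  | .del, x, y => y ≤ x

section SignedLE

variable {A : Type*} {s : Sgn} {x y z : A}

theorem signedLE_opp [LE A] : SignedLE s.opp x y ↔ SignedLE s y x := by
  cases s <;> exact Iff.rfl

theorem SignedLE.refl [Preorder A] (s : Sgn) (x : A) : SignedLE s x x := by
  cases s <;> exact le_refl x

theorem SignedLE.trans [Preorder A] (hxy : SignedLE s x y) (hyz : SignedLE s y z) :
    SignedLE s x z := by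
  cases s
  · exact le_trans (α := A) hxy hyz
  · exact le_trans (α := A) hyz hxy

theorem SignedLE.antisymm [PartialOrder A] (hxy : SignedLE s x y) (hyx : SignedLE s y x) :
    x = y := by
  cases s
  · exact le_antisymm (α := A) hxy hyx
  · exact le_antisymm (α := A) hyx hxy

end SignedLE

/-! ### Residuated operations -/

/-- In each coordinate, with the other arguments fixed, the operation `h` has an adjoint. Whether
it is a left or a right adjoint, and whether the adjunction is a covariant or a contravariant one,
is determined by the output sign `t` and the entry `ε i`. -/
def IsResiduated {C : Type*} [LE C] {n : ℕ} (t : Sgn) (ε : OrderType n) (h : (Fin n → C) → C) :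
    Prop :=
  ∀ (a : Fin n → C) (i : Fin n), ∃ r : C → C, ∀ x y,
    SignedLE t (h (update a i x)) y ↔ SignedLE (t.mul (ε i)) x (r y)

namespace IsResiduated

variable {C : Type*} [Preorder C] {n : ℕ} {t : Sgn} {ε : OrderType n} {h : (Fin n → C) → C}
  {i : Fin n}

/-- The operation adjoint to `h` in the coordinate `i`; the entry `i` of its argument is the element
to which the adjoint is applied, the other entries are the fixed arguments of `h`. -/
noncomputable def residual (hh : IsResiduated t ε h) (i : Fin n) (a : Fin n → C) : C :=
  (hh a i).choose (a i)

theorem signedLE_iff_signedLE_residual (hh : IsResiduated t ε h) (i : Fin n) (a : Fin n → C)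
    (x y : C) :
    SignedLE t (h (update a i x)) y ↔
      SignedLE (t.mul (ε i)) x (hh.residual i (update a i y)) := by
  simpa only [residual, update_idem, update_self] using (hh (update a i y) i).choose_spec x y

theorem isResiduated_residual (hh : IsResiduated t ε h) (i : Fin n) :
    IsResiduated (t.mul (ε i)).opp (residualOrd ε i) (hh.residual i) := by
  intro a j
  rcases eq_or_ne j i with rfl | hji
  · have sign_eq : (t.mul (ε j)).opp.mul (residualOrd ε j j) = t.opp := by
      simp only [residualOrd, if_pos]
      cases t <;> cases ε j <;> rfl
    refine ⟨fun x => h (update a j x), fun y x => ?_⟩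
    rw [sign_eq, signedLE_opp, signedLE_opp, hh.signedLE_iff_signedLE_residual]
  · have sign_eq : (t.mul (ε i)).opp.mul (residualOrd ε i j) = t.mul (ε j) := by
      simp only [residualOrd, if_neg hji]
      cases t <;> cases ε i <;> cases ε j <;> rfl
    choose r hr using fun x : C => hh (update a i x) j
    refine ⟨fun x => r x (a i), fun z x => ?_⟩
    rw [sign_eq, signedLE_opp, ← hr, update_comm hji.symm, hh.signedLE_iff_signedLE_residual,
      update_comm hji, update_eq_self]

theorem galoisConnection_one_one (hh : IsResiduated .one ε h) (hi : ε i = .one) (a : Fin n → C) :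
    GaloisConnection (fun x => h (update a i x)) fun y => hh.residual i (update a i y) := by
  have := hh.signedLE_iff_signedLE_residual i a
  rwa [hi] at this

theorem galoisConnection_one_del (hh : IsResiduated .one ε h) (hi : ε i = .del) (a : Fin n → C) :
    GaloisConnection (fun x : Cᵒᵈ => h (update a i (ofDual x)))
      fun y => toDual (hh.residual i (update a i y)) := by
  have := hh.signedLE_iff_signedLE_residual i a
  rwa [hi] at this

theorem galoisConnection_del_one (hh : IsResiduated .del ε h) (hi : ε i = .one) (a : Fin n → C) :
    GaloisConnection (fun y => hh.residual i (update a i y)) fun x => h (update a i x) := by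
  have := hh.signedLE_iff_signedLE_residual i a
  rw [hi] at this
  exact fun y x => (this x y).symm

theorem galoisConnection_del_del (hh : IsResiduated .del ε h) (hi : ε i = .del) (a : Fin n → C) :
    GaloisConnection (fun y => toDual (hh.residual i (update a i y)))
      fun x : Cᵒᵈ => h (update a i (ofDual x)) := by
  have := hh.signedLE_iff_signedLE_residual i a
  rw [hi] at this
  exact fun y x => (this x y).symm

end IsResiduated

/-! ### Residuated algebras -/

/-- Operations on `L` interpreting the connectives of `S`, residuated in each coordinate. -/
structure ResiduatedAlgebra (S : Signature.{u, v}) (L : Type*) [LE L] where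
  opF (f : S.F) : (Fin (S.arF f) → L) → L
  opG (g : S.G) : (Fin (S.arG g) → L) → L
  isResiduated_opF (f : S.F) : IsResiduated .one (S.ordF f) (opF f)
  isResiduated_opG (g : S.G) : IsResiduated .del (S.ordG g) (opG g)

namespace ResiduatedAlgebra

variable {S : Signature.{u, v}} {P : Type w} {L : Type*}

/-- A residuated algebra interprets the tense signature, the additional connectives being
interpreted by the residuals of the operations. -/
noncomputable def star [Preorder L] (M : ResiduatedAlgebra S L) : ResiduatedAlgebra S.star L where
  opF
    | .base f => M.opF f
    | .sharp f i _ => (M.isResiduated_opF f).residual i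
    | .flat g i _ => (M.isResiduated_opG g).residual i
  opG
    | .base g => M.opG g
    | .sharp f i _ => (M.isResiduated_opF f).residual i
    | .flat g i _ => (M.isResiduated_opG g).residual i
  isResiduated_opF
    | .base f => M.isResiduated_opF f
    | .sharp f i hi => by
      have := (M.isResiduated_opF f).isResiduated_residual i
      rwa [hi] at this
    | .flat g i hi => by
      have := (M.isResiduated_opG g).isResiduated_residual i
      rwa [hi] at this
  isResiduated_opG
    | .base g => M.isResiduated_opG g
    | .sharp f i hi => by
      have := (M.isResiduated_opF f).isResiduated_residual i
      rwa [hi] at this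
    | .flat g i hi => by
      have := (M.isResiduated_opG g).isResiduated_residual i
      rwa [hi] at this

variable [Lattice L] [BoundedOrder L] (M : ResiduatedAlgebra S L) (e : P → L)

/-- The value of a formula under a valuation of the proposition letters. -/
def eval : Formula S P → L
  | .var p => e p
  | .bot => ⊥
  | .top => ⊤
  | .and φ ψ => eval φ ⊓ eval ψ
  | .or φ ψ => eval φ ⊔ eval ψ
  | .opF f a => M.opF f fun i => eval (a i)
  | .opG g a => M.opG g fun i => eval (a i)

/-- A sequent is valid if it holds under all valuations. -/
def Valid (s : Sequent S P) : Prop :=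
  ∀ e : P → L, M.eval e s.lhs ≤ M.eval e s.rhs

theorem eval_subst (σ : P → Formula S P) (φ : Formula S P) :
    M.eval e (φ.subst σ) = M.eval (fun p => M.eval e (σ p)) φ := by
  induction φ with
  | var p => rfl
  | bot => rfl
  | top => rfl
  | and φ ψ hφ hψ => exact congrArg₂ (· ⊓ ·) hφ hψ
  | or φ ψ hφ hψ => exact congrArg₂ (· ⊔ ·) hφ hψ
  | opF f a ih => exact congrArg (M.opF f) (funext ih)
  | opG g a ih => exact congrArg (M.opG g) (funext ih)

theorem eval_update {n : ℕ} (a : Fin n → Formula S P) (i : Fin n) (φ : Formula S P) :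
    (fun j => M.eval e (update a i φ j)) = update (fun j => M.eval e (a j)) i (M.eval e φ) :=
  funext fun j => apply_update (fun _ => M.eval e) a i φ j

theorem eval_atF (f : S.F) (a : Fin (S.arF f) → P) (i : Fin (S.arF f)) (φ : Formula S P) :
    M.eval e (.atF f a i φ) = M.opF f (update (fun j => e (a j)) i (M.eval e φ)) :=
  congrArg (M.opF f) (M.eval_update e _ i φ)

theorem eval_atG (g : S.G) (a : Fin (S.arG g) → P) (i : Fin (S.arG g)) (φ : Formula S P) :
    M.eval e (.atG g a i φ) = M.opG g (update (fun j => e (a j)) i (M.eval e φ)) :=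
  congrArg (M.opG g) (M.eval_update e _ i φ)

theorem valid_of_derivable [DecidableEq P] {R : Sequent S P → Sequent S P → Prop}
    (hR : ∀ s t, R s t → M.Valid s → M.Valid t) {s : Sequent S P} (hs : Derivable S P R s) :
    M.Valid s := by
  induction hs with
    (intro e; try simp only [eval_atF, eval_atG, eval])
  | refl p => exact le_rfl
  | botLe p => exact bot_le
  | leTop p => exact le_top
  | leOrLeft p q => exact le_sup_left
  | leOrRight p q => exact le_sup_right
  | andLeLeft p q => exact inf_le_left
  | andLeRight p q => exact inf_le_right
  | fBot f a i hi => exact ((M.isResiduated_opF f).galoisConnection_one_one hi _).l_bot.le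
  | fTop f a i hi => exact ((M.isResiduated_opF f).galoisConnection_one_del hi _).l_bot.le
  | gTop g a i hi => exact ((M.isResiduated_opG g).galoisConnection_del_one hi _).u_top.ge
  | gBot g a i hi => exact ((M.isResiduated_opG g).galoisConnection_del_del hi _).u_top.ge
  | fOr f a i p q hi => exact ((M.isResiduated_opF f).galoisConnection_one_one hi _).l_sup.le
  | fAnd f a i p q hi => exact ((M.isResiduated_opF f).galoisConnection_one_del hi _).l_sup.le
  | gAnd g a i p q hi => exact ((M.isResiduated_opG g).galoisConnection_del_one hi _).u_inf.ge
  | gOr g a i p q hi => exact ((M.isResiduated_opG g).galoisConnection_del_del hi _).u_inf.ge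
  | cut φ χ ψ _ _ hφχ hχψ => exact (hφχ e).trans (hχψ e)
  | substitution φ ψ χ p _ h =>
    simp only [Formula.subst1, eval_subst]
    exact h _
  | leAnd χ φ ψ _ _ hφ hψ => exact le_inf (hφ e) (hψ e)
  | orLe φ ψ χ _ _ hφ hψ => exact sup_le (hφ e) (hψ e)
  | fMono f a i φ ψ hi _ h =>
    exact ((M.isResiduated_opF f).galoisConnection_one_one hi _).monotone_l (h e)
  | fAnti f a i φ ψ hi _ h =>
    exact ((M.isResiduated_opF f).galoisConnection_one_del hi _).monotone_l (h e)
  | gMono g a i φ ψ hi _ h =>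
    exact ((M.isResiduated_opG g).galoisConnection_del_one hi _).monotone_u (h e)
  | gAnti g a i φ ψ hi _ h =>
    exact ((M.isResiduated_opG g).galoisConnection_del_del hi _).monotone_u (h e)
  | extra s t hst _ h => exact hR s t hst h e

section ResiduationRules

variable {f : S.F} {i : Fin (S.arF f)} {g : S.G} {k : Fin (S.arG g)}
  (a : Fin (S.arF f) → Formula S.star P) (b : Fin (S.arG g) → Formula S.star P)
  (φ ψ : Formula S.star P)

theorem eval_starF_le_iff_of_one (hi : S.ordF f i = .one) :
    M.star.eval e (starF f (update a i φ)) ≤ M.star.eval e ψ ↔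
      M.star.eval e φ ≤ M.star.eval e (sharpOne f i hi (update a i ψ)) := by
  have adj := (M.isResiduated_opF f).galoisConnection_one_one hi (fun j => M.star.eval e (a j))
    (M.star.eval e φ) (M.star.eval e ψ)
  simp only [← eval_update] at adj
  exact adj

theorem eval_starF_le_iff_of_del (hi : S.ordF f i = .del) :
    M.star.eval e (starF f (update a i φ)) ≤ M.star.eval e ψ ↔
      M.star.eval e (sharpDel f i hi (update a i ψ)) ≤ M.star.eval e φ := by
  have adj := (M.isResiduated_opF f).galoisConnection_one_del hi (fun j => M.star.eval e (a j))
    (toDual (M.star.eval e φ)) (M.star.eval e ψ)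
  simp only [← eval_update, ofDual_toDual] at adj
  exact adj

theorem le_eval_starG_iff_of_one (hk : S.ordG g k = .one) :
    M.star.eval e φ ≤ M.star.eval e (starG g (update b k ψ)) ↔
      M.star.eval e (flatOne g k hk (update b k φ)) ≤ M.star.eval e ψ := by
  have adj := (M.isResiduated_opG g).galoisConnection_del_one hk (fun j => M.star.eval e (b j))
    (M.star.eval e φ) (M.star.eval e ψ)
  simp only [← eval_update] at adj
  exact adj.symm

theorem le_eval_starG_iff_of_del (hk : S.ordG g k = .del) :
    M.star.eval e φ ≤ M.star.eval e (starG g (update b k ψ)) ↔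
      M.star.eval e ψ ≤ M.star.eval e (flatDel g k hk (update b k φ)) := by
  have adj := (M.isResiduated_opG g).galoisConnection_del_del hk (fun j => M.star.eval e (b j))
    (M.star.eval e φ) (toDual (M.star.eval e ψ))
  simp only [← eval_update, ofDual_toDual] at adj
  exact adj.symm

end ResiduationRules

theorem star_valid_of_residuationRule {s s' : Sequent S.star P} (hss' : ResiduationRule S P s s')
    (hs : M.star.Valid s) : M.star.Valid s' := by
  intro e
  cases hss' with
  | fOne_down f i hi a φ ψ => exact (M.eval_starF_le_iff_of_one e a φ ψ hi).1 (hs e)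
  | fOne_up f i hi a φ ψ => exact (M.eval_starF_le_iff_of_one e a φ ψ hi).2 (hs e)
  | gOne_down g i hi a φ ψ => exact (M.le_eval_starG_iff_of_one e a φ ψ hi).1 (hs e)
  | gOne_up g i hi a φ ψ => exact (M.le_eval_starG_iff_of_one e a φ ψ hi).2 (hs e)
  | fDel_down f i hi a φ ψ => exact (M.eval_starF_le_iff_of_del e a φ ψ hi).1 (hs e)
  | fDel_up f i hi a φ ψ => exact (M.eval_starF_le_iff_of_del e a φ ψ hi).2 (hs e)
  | gDel_down g i hi a φ ψ => exact (M.le_eval_starG_iff_of_del e a φ ψ hi).1 (hs e)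
  | gDel_up g i hi a φ ψ => exact (M.le_eval_starG_iff_of_del e a φ ψ hi).2 (hs e)

theorem eval_star_toStar (φ : Formula S P) : M.star.eval e φ.toStar = M.eval e φ := by
  induction φ with
  | var p => rfl
  | bot => rfl
  | top => rfl
  | and φ ψ hφ hψ => exact congrArg₂ (· ⊓ ·) hφ hψ
  | or φ ψ hφ hψ => exact congrArg₂ (· ⊔ ·) hφ hψ
  | opF f a ih => exact congrArg (M.opF f) (funext ih)
  | opG g a ih => exact congrArg (M.opG g) (funext ih)

theorem valid_of_toStar_mem_tenseLogic [DecidableEq P] {s : Sequent S P}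
    (hs : s.toStar ∈ tenseLogic S P) : M.Valid s := by
  intro e
  simpa only [Sequent.toStar, eval_star_toStar] using
    M.star.valid_of_derivable (fun _ _ => M.star_valid_of_residuationRule) hs e

end ResiduatedAlgebra

/-! ### The canonical extension of a preorder -/

/-- `X` is a filter (for the sign `1`) or an ideal (for the sign `∂`); both may be improper. -/
structure IsSignedFilter {A : Type*} [LE A] (s : Sgn) (X : Set A) : Prop where
  nonempty : X.Nonempty
  mem_of_signedLE {x y : A} : x ∈ X → SignedLE s x y → y ∈ X
  directedOn : DirectedOn (fun x y => SignedLE s y x) X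

/-- The type of filters (for the sign `1`) or of ideals (for the sign `∂`) of `A`. -/
def SignedFilter (A : Type*) [LE A] (s : Sgn) : Type _ :=
  {X : Set A // IsSignedFilter s X}

namespace SignedFilter

variable {A : Type*}

instance [LE A] {s : Sgn} : SetLike (SignedFilter A s) A where
  coe := Subtype.val
  coe_injective := Subtype.val_injective

variable [Preorder A] {s : Sgn}

/-- The filter or ideal generated by `a`. -/
def principal (s : Sgn) (a : A) : SignedFilter A s where
  val := {b | SignedLE s a b}
  property :=
    { nonempty := ⟨a, .refl s a⟩
      mem_of_signedLE := .trans
      directedOn := fun _ hx _ hy => ⟨a, .refl s a, hx, hy⟩ }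

theorem mem_principal_self (a : A) : a ∈ principal s a := .refl s a

theorem top_mem (X : SignedFilter A .one) {a : A} (ha : IsTop a) : a ∈ X :=
  let ⟨b, hb⟩ := X.2.nonempty
  X.2.mem_of_signedLE hb (ha b)

theorem bot_mem (X : SignedFilter A .del) {a : A} (ha : IsBot a) : a ∈ X :=
  let ⟨b, hb⟩ := X.2.nonempty
  X.2.mem_of_signedLE hb (ha b)

theorem mem_iff_of_isGLB (X : SignedFilter A .one) {a b c : A} (ha : IsGLB {b, c} a) :
    a ∈ X ↔ b ∈ X ∧ c ∈ X := by
  refine ⟨fun h => ?_, fun ⟨hb, hc⟩ => ?_⟩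
  · exact ⟨X.2.mem_of_signedLE h (ha.1 (.inl rfl)), X.2.mem_of_signedLE h (ha.1 (.inr rfl))⟩
  · obtain ⟨z, hz, hzb, hzc⟩ := X.2.directedOn b hb c hc
    exact X.2.mem_of_signedLE hz (ha.2 (by simpa using ⟨hzb, hzc⟩))

theorem mem_iff_of_isLUB (X : SignedFilter A .del) {a b c : A} (ha : IsLUB {b, c} a) :
    a ∈ X ↔ b ∈ X ∧ c ∈ X := by
  refine ⟨fun h => ?_, fun ⟨hb, hc⟩ => ?_⟩
  · exact ⟨X.2.mem_of_signedLE h (ha.1 (.inl rfl)), X.2.mem_of_signedLE h (ha.1 (.inr rfl))⟩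
  · obtain ⟨z, hz, hbz, hcz⟩ := X.2.directedOn b hb c hc
    exact X.2.mem_of_signedLE hz (ha.2 (by simpa using ⟨hbz, hcz⟩))

end SignedFilter

/-- The canonical extension of `A`: the complete lattice of concepts of the relation "the filter `X`
meets the ideal `Y`". -/
abbrev CanonicalExtension (A : Type*) [LE A] : Type _ :=
  Concept (SignedFilter A .one) (SignedFilter A .del) fun X Y => ∃ a ∈ X, a ∈ Y

namespace CanonicalExtension

variable {A : Type*}

section LE

variable [LE A]

/-- The filters below `u` (for the sign `1`) or the ideals above `u` (for the sign `∂`). -/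
def side : (s : Sgn) → CanonicalExtension A → Set (SignedFilter A s)
  | .one, u => u.extent
  | .del, u => u.intent

/-- The least element above the filters in `T` (for the sign `1`) or the greatest element below the
ideals in `T` (for the sign `∂`). -/
def ofSide : (s : Sgn) → Set (SignedFilter A s) → CanonicalExtension A
  | .one, T => .ofObjects _ T
  | .del, T => .ofAttributes _ T

variable {s : Sgn} {u v : CanonicalExtension A}

theorem side_subset_side : side s u ⊆ side s v ↔ SignedLE s u v := by
  cases s
  · exact Concept.extent_subset_extent_iff
  · exact Concept.intent_subset_intent_iff

theorem ext_side (s : Sgn) (h : ∀ X, X ∈ side s u ↔ X ∈ side s v) : u = v :=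
  SignedLE.antisymm (side_subset_side.1 fun X => (h X).1) (side_subset_side.1 fun X => (h X).2)

theorem side_ofSide (T : Set (SignedFilter A s))
    (hT : ∀ X ∉ T, ∃ Y : SignedFilter A s.opp,
      (∀ X' ∈ T, ∃ a ∈ X', a ∈ Y) ∧ ¬ ∃ a ∈ X, a ∈ Y) :
    side s (ofSide s T) = T := by
  refine Set.Subset.antisymm (fun X hX => by_contra fun hXT => ?_) ?_
  · obtain ⟨Y, hTY, hXY⟩ := hT X hXT
    cases s
    · exact hXY (hX hTY)
    · obtain ⟨a, haY, haX⟩ := hX fun X' hX' => (hTY X' hX').imp fun _ h => h.symm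
      exact hXY ⟨a, haX, haY⟩
  · cases s
    · exact fun X hX Y hY => hY hX
    · exact fun X hX Y hY => hY hX

end LE

variable [Preorder A]

/-- The embedding of `A` into its canonical extension. -/
def embed (a : A) : CanonicalExtension A := ofSide .one {X | a ∈ X}

theorem mem_side_embed {s : Sgn} {a : A} {X : SignedFilter A s} :
    X ∈ side s (embed a) ↔ a ∈ X := by
  have side_one : side .one (embed a) = {X | a ∈ X} :=
    side_ofSide _ fun X hX => ⟨.principal _ a, fun _ hX' => ⟨a, hX', .refl Sgn.del a⟩,
      fun ⟨_, hbX, hba⟩ => hX (X.2.mem_of_signedLE hbX hba)⟩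
  cases s
  · rw [side_one, Set.mem_ofPred_eq]
  · change X ∈ (embed a).intent ↔ a ∈ X
    rw [← Concept.upperPolar_extent, show (embed a).extent = _ from side_one]
    refine ⟨fun hX => ?_, fun ha Y hY => ⟨a, hY, ha⟩⟩
    obtain ⟨b, hab, hbX⟩ := hX (a := .principal .one a) (SignedLE.refl .one a)
    exact X.2.mem_of_signedLE hbX hab

theorem embed_le_embed {a b : A} : embed a ≤ embed b ↔ a ≤ b := by
  refine (side_subset_side (s := .one)).symm.trans ⟨fun h => ?_, fun hab X hX => ?_⟩
  · exact mem_side_embed.1 (h (mem_side_embed.2 (SignedFilter.mem_principal_self a)))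
  · exact mem_side_embed.2 (X.2.mem_of_signedLE (mem_side_embed.1 hX) hab)

theorem embed_eq_top {a : A} (ha : IsTop a) : embed a = ⊤ :=
  ext_side .one fun X => ⟨fun _ => Set.mem_univ X, fun _ => mem_side_embed.2 (X.top_mem ha)⟩

theorem embed_eq_bot {a : A} (ha : IsBot a) : embed a = ⊥ :=
  ext_side .del fun X => ⟨fun _ => Set.mem_univ X, fun _ => mem_side_embed.2 (X.bot_mem ha)⟩

theorem embed_eq_inf {a b c : A} (ha : IsGLB {b, c} a) : embed a = embed b ⊓ embed c :=
  ext_side .one fun X => mem_side_embed.trans <| (X.mem_iff_of_isGLB ha).trans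
    (and_congr mem_side_embed mem_side_embed).symm

theorem embed_eq_sup {a b c : A} (ha : IsLUB {b, c} a) : embed a = embed b ⊔ embed c :=
  ext_side .del fun X => mem_side_embed.trans <| (X.mem_iff_of_isLUB ha).trans
    (and_congr mem_side_embed mem_side_embed).symm

end CanonicalExtension

/-! ### Extension of normal operations -/

theorem rel_of_forall_update {ι γ : Type*} [Finite ι] [DecidableEq ι] {α : ι → Type*}
    {k : (∀ i, α i) → γ} {R : γ → γ → Prop} [Std.Refl R] [IsTrans γ R]
    {r : ∀ i, α i → α i → Prop}
    (hk : ∀ a i x y, r i x y → R (k (update a i x)) (k (update a i y))) {a b : ∀ i, α i}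
    (hab : ∀ i, r i (a i) (b i)) : R (k a) (k b) := by
  have := Fintype.ofFinite ι
  suffices ∀ s : Finset ι, R (k a) (k (s.piecewise b a)) by
    simpa only [Finset.piecewise_univ] using this Finset.univ
  intro s
  induction s using Finset.induction_on with
  | empty => simpa only [Finset.piecewise_empty] using refl_of R (k a)
  | insert i s hi ih =>
    refine _root_.trans ih ?_
    rw [Finset.piecewise_insert]
    nth_rw 1 [← update_eq_self i (s.piecewise b a)]
    rw [Finset.piecewise_eq_of_notMem _ _ _ hi]
    exact hk _ i _ _ (hab i)

/-- `h` is a normal operation of order-type `ε`: in each coordinate, the inverse image of an ideal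
(for the output sign `1`) or of a filter (for the output sign `∂`) is again an ideal or a filter.
On a bounded lattice this means that `h` preserves or reverses, as prescribed by the signs, finite
joins or meets in each coordinate. -/
def IsNormalOp {A : Type*} [LE A] {n : ℕ} (t : Sgn) (ε : OrderType n) (h : (Fin n → A) → A) :
    Prop :=
  ∀ (J : SignedFilter A t.opp) (a : Fin n → A) (i : Fin n),
    IsSignedFilter (t.mul (ε i)).opp {x | h (update a i x) ∈ J}

/-- Some value of `h` on the product of the sets `X i` lies in `J`. -/
def ImageMeets {A : Type*} [LE A] {n : ℕ} {s : Fin n → Sgn} {s' : Sgn} (h : (Fin n → A) → A)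
    (X : ∀ i, SignedFilter A (s i)) (J : SignedFilter A s') : Prop :=
  ∃ a : Fin n → A, (∀ i, a i ∈ X i) ∧ h a ∈ J

open CanonicalExtension in
/-- The extension of an operation of `A` to the canonical extension: for `t = 1` its value is
determined by the ideals that meet every image of filters or ideals below the arguments. -/
def extension {A : Type*} [LE A] {n : ℕ} (t : Sgn) (ε : OrderType n) (h : (Fin n → A) → A)
    (u : Fin n → CanonicalExtension A) : CanonicalExtension A :=
  ofSide t.opp {J | ∀ X : ∀ i, SignedFilter A (t.mul (ε i)), (∀ i, X i ∈ side _ (u i)) →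
    ImageMeets h X J}

open CanonicalExtension in
/-- The filters or ideals that determine the value at `v` of the adjoint of `extension t ε h` in the
coordinate `i`, the other arguments being those of `u`. -/
def residualSide {A : Type*} [LE A] {n : ℕ} (t : Sgn) (ε : OrderType n) (h : (Fin n → A) → A)
    (i : Fin n) (u : Fin n → CanonicalExtension A) (v : CanonicalExtension A) :
    Set (SignedFilter A (t.mul (ε i))) :=
  {Z | ∀ J ∈ side t.opp v, ∀ X : ∀ j, SignedFilter A (t.mul (ε j)),
    (∀ j ≠ i, X j ∈ side _ (u j)) → ImageMeets h (update X i Z) J}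

namespace IsNormalOp

open CanonicalExtension

variable {A : Type*} [Preorder A] {n : ℕ} {t : Sgn} {ε : OrderType n} {h : (Fin n → A) → A}

theorem signedLE_update (hh : IsNormalOp t ε h) (a : Fin n → A) (i : Fin n) (x y : A)
    (hxy : SignedLE (t.mul (ε i)) x y) : SignedLE t (h (update a i x)) (h (update a i y)) :=
  signedLE_opp.1 <| (hh (.principal t.opp (h (update a i y))) a i).mem_of_signedLE
    (SignedFilter.mem_principal_self _) (signedLE_opp.2 hxy)

theorem signedLE_of_forall (hh : IsNormalOp t ε h) {a b : Fin n → A}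
    (hab : ∀ i, SignedLE (t.mul (ε i)) (a i) (b i)) : SignedLE t (h a) (h b) :=
  have : Std.Refl (SignedLE (A := A) t) := ⟨.refl t⟩
  have : IsTrans A (SignedLE t) := ⟨fun _ _ _ => .trans⟩
  rel_of_forall_update hh.signedLE_update hab

theorem isSignedFilter_image (hh : IsNormalOp t ε h) (X : ∀ i, SignedFilter A (t.mul (ε i))) :
    IsSignedFilter t {b | ∃ a : Fin n → A, (∀ i, a i ∈ X i) ∧ SignedLE t (h a) b} where
  nonempty := by
    choose a ha using fun i => (X i).2.nonempty
    exact ⟨h a, a, ha, .refl t _⟩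
  mem_of_signedLE := fun ⟨a, ha, hab⟩ hbc => ⟨a, ha, hab.trans hbc⟩
  directedOn := by
    rintro x ⟨a, ha, hax⟩ y ⟨b, hb, hby⟩
    choose c hc hca hcb using fun i => (X i).2.directedOn (a i) (ha i) (b i) (hb i)
    exact ⟨h c, ⟨c, hc, .refl t _⟩, (hh.signedLE_of_forall hca).trans hax,
      (hh.signedLE_of_forall hcb).trans hby⟩

theorem isSignedFilter_preimage (hh : IsNormalOp t ε h) (X : ∀ i, SignedFilter A (t.mul (ε i)))
    (J : SignedFilter A t.opp) (i : Fin n) :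
    IsSignedFilter (t.mul (ε i)).opp
      {x | ∃ a : Fin n → A, (∀ j, a j ∈ X j) ∧ h (update a i x) ∈ J} where
  nonempty := by
    choose a ha using fun j => (X j).2.nonempty
    exact (hh J a i).nonempty.imp fun x hx => ⟨a, ha, hx⟩
  mem_of_signedLE := fun ⟨a, ha, hx⟩ hxy => ⟨a, ha, (hh J a i).mem_of_signedLE hx hxy⟩
  directedOn := by
    rintro x ⟨a, ha, hx⟩ y ⟨b, hb, hy⟩
    choose c hc hca hcb using fun j => (X j).2.directedOn (a j) (ha j) (b j) (hb j)
    have mem_of_forall {d : Fin n → A} {z : A} (hcd : ∀ j, SignedLE (t.mul (ε j)) (c j) (d j))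
        (hz : h (update d i z) ∈ J) : h (update c i z) ∈ J := by
      refine J.2.mem_of_signedLE hz (signedLE_opp.2 (hh.signedLE_of_forall fun j => ?_))
      rcases eq_or_ne j i with rfl | hji
      · simpa only [update_self] using SignedLE.refl _ z
      · simpa only [update_of_ne hji] using hcd j
    obtain ⟨z, hz, hxz, hyz⟩ :=
      (hh J c i).directedOn x (mem_of_forall hca hx) y (mem_of_forall hcb hy)
    exact ⟨z, ⟨c, hc, hz⟩, hxz, hyz⟩

theorem side_extension (hh : IsNormalOp t ε h) (u : Fin n → CanonicalExtension A) :
    side t.opp (extension t ε h u) =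
      {J | ∀ X : ∀ i, SignedFilter A (t.mul (ε i)), (∀ i, X i ∈ side _ (u i)) →
        ImageMeets h X J} := by
  refine side_ofSide _ fun J hJ => ?_
  simp only [Set.mem_ofPred_eq, not_forall] at hJ
  obtain ⟨X, hX, hJX⟩ := hJ
  refine ⟨⟨{b | ∃ a : Fin n → A, (∀ i, a i ∈ X i) ∧ SignedLE t (h a) b},
    by simpa only [Sgn.opp_opp] using hh.isSignedFilter_image X⟩, fun J' hJ' => ?_, ?_⟩
  · obtain ⟨a, ha, haJ⟩ := hJ' X hX
    exact ⟨h a, haJ, a, ha, .refl t _⟩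
  · rintro ⟨b, hb, a, ha, hab⟩
    exact hJX ⟨a, ha, J.2.mem_of_signedLE hb (signedLE_opp.2 hab)⟩

theorem side_ofSide_residualSide (hh : IsNormalOp t ε h) (i : Fin n)
    (u : Fin n → CanonicalExtension A) (v : CanonicalExtension A) :
    side _ (ofSide _ (residualSide t ε h i u v)) = residualSide t ε h i u v := by
  refine side_ofSide _ fun Z hZ => ?_
  simp only [residualSide, Set.mem_ofPred_eq, not_forall] at hZ
  obtain ⟨J, hJ, X, hX, hJX⟩ := hZ
  refine ⟨⟨_, hh.isSignedFilter_preimage (update X i Z) J i⟩, fun Z' hZ' => ?_, ?_⟩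
  · obtain ⟨a, ha, haJ⟩ := hZ' J hJ X hX
    obtain ⟨z, hz : z ∈ Z⟩ := Z.2.nonempty
    refine ⟨a i, by simpa only [update_self] using ha i, update a i z, fun j => ?_, ?_⟩
    · rcases eq_or_ne j i with rfl | hji
      · simpa only [update_self] using hz
      · simpa only [update_of_ne hji] using ha j
    · rwa [update_idem, update_eq_self]
  · rintro ⟨x, hx, a, ha, hax⟩
    refine hJX ⟨update a i x, fun j => ?_, hax⟩
    rcases eq_or_ne j i with rfl | hji
    · simpa only [update_self] using hx
    · simpa only [update_of_ne hji] using ha j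

theorem isResiduated_extension (hh : IsNormalOp t ε h) : IsResiduated t ε (extension t ε h) := by
  refine fun u i => ⟨fun y => ofSide _ (residualSide t ε h i u y), fun x y => ?_⟩
  rw [← signedLE_opp, ← side_subset_side, ← side_subset_side, hh.side_extension,
    hh.side_ofSide_residualSide i u y]
  constructor
  · intro H Z hZ J hJ X hX
    refine H hJ (update X i Z) fun j => ?_
    rcases eq_or_ne j i with rfl | hji
    · simpa only [update_self] using hZ
    · simpa only [update_of_ne hji] using hX j hji
  · intro H J hJ X hX
    have := H (by simpa only [update_self] using hX i) J hJ X fun j hji => by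
      simpa only [update_of_ne hji] using hX j
    rwa [update_eq_self] at this

theorem extension_embed (hh : IsNormalOp t ε h) (a : Fin n → A) :
    extension t ε h (fun i => embed (a i)) = embed (h a) := by
  refine ext_side t.opp fun J => ?_
  rw [hh.side_extension, mem_side_embed]
  refine ⟨fun H => ?_, fun ha X hX => ⟨a, fun i => mem_side_embed.1 (hX i), ha⟩⟩
  obtain ⟨b, hb, hbJ⟩ := H (fun i => .principal _ (a i))
    fun i => mem_side_embed.2 (SignedFilter.mem_principal_self _)
  exact J.2.mem_of_signedLE hbJ (signedLE_opp.2 (hh.signedLE_of_forall hb))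

end IsNormalOp

/-! ### Simultaneous substitution -/

namespace Formula

variable {S : Signature.{u, v}} {P : Type w}

/-- The proposition letters occurring in a formula. -/
def letters : Formula S P → Set P
  | .var p => {p}
  | .bot => ∅
  | .top => ∅
  | .and φ ψ => φ.letters ∪ ψ.letters
  | .or φ ψ => φ.letters ∪ ψ.letters
  | .opF _ a => ⋃ i, (a i).letters
  | .opG _ a => ⋃ i, (a i).letters

theorem finite_letters (φ : Formula S P) : φ.letters.Finite := by
  induction φ with
  | var p => exact Set.finite_singleton p
  | bot => exact Set.finite_empty
  | top => exact Set.finite_empty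
  | and φ ψ hφ hψ => exact hφ.union hψ
  | or φ ψ hφ hψ => exact hφ.union hψ
  | opF f a ha => exact Set.finite_iUnion ha
  | opG g a ha => exact Set.finite_iUnion ha

theorem subst_congr {σ τ : P → Formula S P} {φ : Formula S P}
    (h : ∀ p ∈ φ.letters, σ p = τ p) : φ.subst σ = φ.subst τ := by
  induction φ with
  | var p => exact h p rfl
  | bot => rfl
  | top => rfl
  | and φ ψ hφ hψ =>
    exact congrArg₂ and (hφ fun p hp => h p (.inl hp)) (hψ fun p hp => h p (.inr hp))
  | or φ ψ hφ hψ =>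
    exact congrArg₂ or (hφ fun p hp => h p (.inl hp)) (hψ fun p hp => h p (.inr hp))
  | opF f a ha =>
    exact congrArg (opF f) (funext fun i => ha i fun p hp => h p (Set.mem_iUnion_of_mem i hp))
  | opG g a ha =>
    exact congrArg (opG g) (funext fun i => ha i fun p hp => h p (Set.mem_iUnion_of_mem i hp))

theorem subst_var (φ : Formula S P) : φ.subst var = φ := by
  induction φ with
  | var p => rfl
  | bot => rfl
  | top => rfl
  | and φ ψ hφ hψ => exact congrArg₂ and hφ hψ
  | or φ ψ hφ hψ => exact congrArg₂ or hφ hψ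
  | opF f a ha => exact congrArg (opF f) (funext ha)
  | opG g a ha => exact congrArg (opG g) (funext ha)

theorem subst_eq_self {σ : P → Formula S P} {φ : Formula S P}
    (h : ∀ p ∈ φ.letters, σ p = var p) : φ.subst σ = φ :=
  (subst_congr h).trans φ.subst_var

theorem subst_subst (σ τ : P → Formula S P) (φ : Formula S P) :
    (φ.subst σ).subst τ = φ.subst fun p => (σ p).subst τ := by
  induction φ with
  | var p => rfl
  | bot => rfl
  | top => rfl
  | and φ ψ hφ hψ => exact congrArg₂ and hφ hψ
  | or φ ψ hφ hψ => exact congrArg₂ or hφ hψ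
  | opF f a ha => exact congrArg (opF f) (funext ha)
  | opG g a ha => exact congrArg (opG g) (funext ha)

theorem subst_atF (σ : P → Formula S P) (f : S.F) (a : Fin (S.arF f) → P) (i : Fin (S.arF f))
    (φ : Formula S P) :
    (atF f a i φ).subst σ = opF f (update (fun j => σ (a j)) i (φ.subst σ)) :=
  congrArg (opF f) (funext fun j => apply_update (fun _ => subst σ) _ i φ j)

theorem subst_atG (σ : P → Formula S P) (g : S.G) (a : Fin (S.arG g) → P) (i : Fin (S.arG g))
    (φ : Formula S P) :
    (atG g a i φ).subst σ = opG g (update (fun j => σ (a j)) i (φ.subst σ)) :=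
  congrArg (opG g) (funext fun j => apply_update (fun _ => subst σ) _ i φ j)

theorem subst1_subst_update_subst1 [DecidableEq P] {σ : P → Formula S P} {p q : P}
    {φ : Formula S P} (hqp : q ≠ p) (hσq : σ q = var q)
    (hqσ : ∀ x ∈ φ.letters, x ≠ p → q ∉ (σ x).letters) :
    ((φ.subst1 (var q) p).subst (update σ p (var p))).subst1 (σ p) q = φ.subst σ := by
  simp only [subst1, subst_subst]
  refine subst_congr fun x hx => ?_
  rcases eq_or_ne x p with rfl | hxp
  · simp only [update_self, subst, update_of_ne hqp, hσq]
  · simp only [update_of_ne hxp, subst]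
    exact subst_eq_self fun y hy =>
      update_of_ne (ne_of_mem_of_not_mem hy (hqσ x hx hxp)) _ _

theorem exists_fresh_substitution [Infinite P] {n : ℕ} (b : Fin n → Formula S P) {T : Set P}
    (hT : T.Finite) :
    ∃ (a : Fin n → P) (σ : P → Formula S P), (fun j => σ (a j)) = b ∧ ∀ p ∈ T, σ p = var p := by
  have := hT.infinite_compl.to_subtype
  let ι := Infinite.natEmbedding (↥Tᶜ)
  let a : Fin n → P := fun j => ι j
  have ha : Injective a := fun i j hij => Fin.ext (ι.injective (Subtype.ext hij))
  exact ⟨a, extend a b var, funext fun j => ha.extend_apply _ _ j, fun p hp =>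
    extend_apply' _ _ _ fun ⟨j, hj⟩ => (ι j).2 (by rwa [← hj] at hp)⟩

theorem exists_substitution_pair [Infinite P] (φ ψ : Formula S P) :
    ∃ (p q : P) (σ : P → Formula S P), σ p = φ ∧ σ q = ψ := by
  obtain ⟨a, σ, h, -⟩ := exists_fresh_substitution ![φ, ψ] Set.finite_empty
  exact ⟨a 0, a 1, σ, congrFun h 0, congrFun h 1⟩

theorem exists_substitution_cons_cons [Infinite P] {n : ℕ} (b : Fin n → Formula S P)
    (φ ψ : Formula S P) :
    ∃ (a : Fin n → P) (p q : P) (σ : P → Formula S P),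
      (fun j => σ (a j)) = b ∧ σ p = φ ∧ σ q = ψ := by
  obtain ⟨a, σ, h, -⟩ := exists_fresh_substitution (Fin.cons φ (Fin.cons ψ b)) Set.finite_empty
  exact ⟨fun j => a j.succ.succ, a 0, a 1, σ, funext fun j => congrFun h j.succ.succ,
    congrFun h 0, congrFun h 1⟩

end Formula

namespace Derivable

variable {S : Signature.{u, v}} {P : Type w} [DecidableEq P] [Infinite P]
  {R : Sequent S P → Sequent S P → Prop}

theorem subst_of_finite_support (T : Finset P) {φ ψ : Formula S P} {σ : P → Formula S P}
    (hσ : ∀ p ∉ T, σ p = .var p) (h : Derivable S P R ⟨φ, ψ⟩) :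
    Derivable S P R ⟨φ.subst σ, ψ.subst σ⟩ := by
  induction T using Finset.induction_on generalizing φ ψ σ with
  | empty =>
    rwa [Formula.subst_eq_self fun p _ => hσ p (Finset.notMem_empty p),
      Formula.subst_eq_self fun p _ => hσ p (Finset.notMem_empty p)]
  | insert p T hp ih =>
    -- Rename `p` to a fresh letter `q`, substitute for the letters in `T`, then `σ p` for `q`.
    have hφψ := φ.finite_letters.union ψ.finite_letters
    obtain ⟨q, hq⟩ := ((hφψ.biUnion fun x _ => (σ x).finite_letters).union
      (insert p T).finite_toSet).exists_notMem
    simp only [Set.mem_union, Set.mem_iUnion, Finset.mem_coe, not_or, not_exists] at hq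
    obtain ⟨hqσ, hqT⟩ := hq
    have hqp : q ≠ p := fun hqp => hqT (hqp ▸ Finset.mem_insert_self q T)
    rw [← Formula.subst1_subst_update_subst1 hqp (hσ q hqT) fun x hx _ => hqσ x (.inl hx),
      ← Formula.subst1_subst_update_subst1 hqp (hσ q hqT) fun x hx _ => hqσ x (.inr hx)]
    refine .substitution _ _ _ _ (ih (fun x hx => ?_) (.substitution _ _ _ _ h))
    rcases eq_or_ne x p with rfl | hxp
    · exact update_self _ _ _
    · rw [update_of_ne hxp]
      exact hσ x fun hxpT => (Finset.mem_insert.1 hxpT).elim hxp hx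

theorem subst (σ : P → Formula S P) {φ ψ : Formula S P} (h : Derivable S P R ⟨φ, ψ⟩) :
    Derivable S P R ⟨φ.subst σ, ψ.subst σ⟩ := by
  have hfin := φ.finite_letters.union ψ.finite_letters
  have := h.subst_of_finite_support (σ := fun p => if p ∈ hfin.toFinset then σ p else .var p)
    hfin.toFinset fun p hp => if_neg hp
  rwa [Formula.subst_congr (τ := σ) fun p hp => if_pos (hfin.mem_toFinset.2 (.inl hp)),
    Formula.subst_congr (τ := σ) fun p hp => if_pos (hfin.mem_toFinset.2 (.inr hp))] at this

end Derivable

/-! ### The canonical extension of the preorder of formulas -/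

namespace Formula

variable {S : Signature.{u, v}} {P : Type w} [DecidableEq P] [Infinite P]

/-- Formulas are preordered by derivability in the basic logic. -/
instance : Preorder (Formula S P) where
  le φ ψ := ⟨φ, ψ⟩ ∈ basicLogic S P
  le_refl φ :=
    let ⟨p⟩ : Nonempty P := inferInstance
    (Derivable.refl p).subst fun _ => φ
  le_trans := .cut

theorem subst_mono (σ : P → Formula S P) : Monotone (subst σ) := fun _ _ => .subst σ

theorem isBot_bot : IsBot (bot : Formula S P) := fun φ =>
  let ⟨p⟩ : Nonempty P := inferInstance
  subst_mono (fun _ => φ) (Derivable.botLe p)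

theorem isTop_top : IsTop (top : Formula S P) := fun φ =>
  let ⟨p⟩ : Nonempty P := inferInstance
  subst_mono (fun _ => φ) (Derivable.leTop p)

theorem le_or_left (φ ψ : Formula S P) : φ ≤ or φ ψ := by
  obtain ⟨p, q, σ, rfl, rfl⟩ := exists_substitution_pair φ ψ
  exact subst_mono σ (Derivable.leOrLeft p q)

theorem le_or_right (φ ψ : Formula S P) : ψ ≤ or φ ψ := by
  obtain ⟨p, q, σ, rfl, rfl⟩ := exists_substitution_pair φ ψ
  exact subst_mono σ (Derivable.leOrRight p q)

theorem and_le_left (φ ψ : Formula S P) : and φ ψ ≤ φ := by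
  obtain ⟨p, q, σ, rfl, rfl⟩ := exists_substitution_pair φ ψ
  exact subst_mono σ (Derivable.andLeLeft p q)

theorem and_le_right (φ ψ : Formula S P) : and φ ψ ≤ ψ := by
  obtain ⟨p, q, σ, rfl, rfl⟩ := exists_substitution_pair φ ψ
  exact subst_mono σ (Derivable.andLeRight p q)

theorem isLUB_or (φ ψ : Formula S P) : IsLUB {φ, ψ} (or φ ψ) :=
  ⟨by simpa using ⟨le_or_left φ ψ, le_or_right φ ψ⟩,
    fun χ h => .orLe φ ψ χ (h (.inl rfl)) (h (.inr rfl))⟩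

theorem isGLB_and (φ ψ : Formula S P) : IsGLB {φ, ψ} (and φ ψ) :=
  ⟨by simpa using ⟨and_le_left φ ψ, and_le_right φ ψ⟩,
    fun χ h => .leAnd χ φ ψ (h (.inl rfl)) (h (.inr rfl))⟩

section OpF

variable {f : S.F} (b : Fin (S.arF f) → Formula S P) {i : Fin (S.arF f)} {φ ψ : Formula S P}

theorem opF_mono (hi : S.ordF f i = .one) (h : φ ≤ ψ) :
    opF f (update b i φ) ≤ opF f (update b i ψ) := by
  obtain ⟨a, σ, rfl, hσ⟩ :=
    exists_fresh_substitution b (φ.finite_letters.union ψ.finite_letters)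
  simpa only [subst_atF, subst_eq_self fun p hp => hσ p (.inl hp),
    subst_eq_self fun p hp => hσ p (.inr hp)] using subst_mono σ (Derivable.fMono f a i φ ψ hi h)

theorem opF_anti (hi : S.ordF f i = .del) (h : φ ≤ ψ) :
    opF f (update b i ψ) ≤ opF f (update b i φ) := by
  obtain ⟨a, σ, rfl, hσ⟩ :=
    exists_fresh_substitution b (φ.finite_letters.union ψ.finite_letters)
  simpa only [subst_atF, subst_eq_self fun p hp => hσ p (.inl hp),
    subst_eq_self fun p hp => hσ p (.inr hp)] using subst_mono σ (Derivable.fAnti f a i φ ψ hi h)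

theorem opF_bot_le (hi : S.ordF f i = .one) : opF f (update b i bot) ≤ bot := by
  obtain ⟨a, σ, rfl, -⟩ := exists_fresh_substitution b Set.finite_empty
  simpa only [subst, subst_atF] using subst_mono σ (Derivable.fBot f a i hi)

theorem opF_top_le (hi : S.ordF f i = .del) : opF f (update b i top) ≤ bot := by
  obtain ⟨a, σ, rfl, -⟩ := exists_fresh_substitution b Set.finite_empty
  simpa only [subst, subst_atF] using subst_mono σ (Derivable.fTop f a i hi)

variable (φ ψ)

theorem opF_or_le (hi : S.ordF f i = .one) :
    opF f (update b i (or φ ψ)) ≤ or (opF f (update b i φ)) (opF f (update b i ψ)) := by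
  obtain ⟨a, p, q, σ, rfl, rfl, rfl⟩ := exists_substitution_cons_cons b φ ψ
  simpa only [subst, subst_atF] using subst_mono σ (Derivable.fOr f a i p q hi)

theorem opF_and_le (hi : S.ordF f i = .del) :
    opF f (update b i (and φ ψ)) ≤ or (opF f (update b i φ)) (opF f (update b i ψ)) := by
  obtain ⟨a, p, q, σ, rfl, rfl, rfl⟩ := exists_substitution_cons_cons b φ ψ
  simpa only [subst, subst_atF] using subst_mono σ (Derivable.fAnd f a i p q hi)

end OpF

section OpG

variable {g : S.G} (b : Fin (S.arG g) → Formula S P) {i : Fin (S.arG g)} {φ ψ : Formula S P}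

theorem opG_mono (hi : S.ordG g i = .one) (h : φ ≤ ψ) :
    opG g (update b i φ) ≤ opG g (update b i ψ) := by
  obtain ⟨a, σ, rfl, hσ⟩ :=
    exists_fresh_substitution b (φ.finite_letters.union ψ.finite_letters)
  simpa only [subst_atG, subst_eq_self fun p hp => hσ p (.inl hp),
    subst_eq_self fun p hp => hσ p (.inr hp)] using subst_mono σ (Derivable.gMono g a i φ ψ hi h)

theorem opG_anti (hi : S.ordG g i = .del) (h : φ ≤ ψ) :
    opG g (update b i ψ) ≤ opG g (update b i φ) := by
  obtain ⟨a, σ, rfl, hσ⟩ :=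
    exists_fresh_substitution b (φ.finite_letters.union ψ.finite_letters)
  simpa only [subst_atG, subst_eq_self fun p hp => hσ p (.inl hp),
    subst_eq_self fun p hp => hσ p (.inr hp)] using subst_mono σ (Derivable.gAnti g a i φ ψ hi h)

theorem le_opG_top (hi : S.ordG g i = .one) : top ≤ opG g (update b i top) := by
  obtain ⟨a, σ, rfl, -⟩ := exists_fresh_substitution b Set.finite_empty
  simpa only [subst, subst_atG] using subst_mono σ (Derivable.gTop g a i hi)

theorem le_opG_bot (hi : S.ordG g i = .del) : top ≤ opG g (update b i bot) := by
  obtain ⟨a, σ, rfl, -⟩ := exists_fresh_substitution b Set.finite_empty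
  simpa only [subst, subst_atG] using subst_mono σ (Derivable.gBot g a i hi)

variable (φ ψ)

theorem le_opG_and (hi : S.ordG g i = .one) :
    and (opG g (update b i φ)) (opG g (update b i ψ)) ≤ opG g (update b i (and φ ψ)) := by
  obtain ⟨a, p, q, σ, rfl, rfl, rfl⟩ := exists_substitution_cons_cons b φ ψ
  simpa only [subst, subst_atG] using subst_mono σ (Derivable.gAnd g a i p q hi)

theorem le_opG_or (hi : S.ordG g i = .del) :
    and (opG g (update b i φ)) (opG g (update b i ψ)) ≤ opG g (update b i (or φ ψ)) := by
  obtain ⟨a, p, q, σ, rfl, rfl, rfl⟩ := exists_substitution_cons_cons b φ ψ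
  simpa only [subst, subst_atG] using subst_mono σ (Derivable.gOr g a i p q hi)

end OpG

theorem isNormalOp_opF (f : S.F) : IsNormalOp .one (S.ordF f) (opF (P := P) f) := by
  intro (J : SignedFilter (Formula S P) .del) a i
  have mem_of_le_or {χ φ ψ : Formula S P} (hφ : φ ∈ J) (hψ : ψ ∈ J) (hχ : χ ≤ or φ ψ) : χ ∈ J :=
    J.2.mem_of_signedLE ((J.mem_iff_of_isLUB (isLUB_or φ ψ)).2 ⟨hφ, hψ⟩) hχ
  cases hi : S.ordF f i
  · exact
      { nonempty := ⟨bot, J.2.mem_of_signedLE (J.bot_mem isBot_bot) (opF_bot_le a hi)⟩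
        mem_of_signedLE := fun hx hxy => J.2.mem_of_signedLE hx (opF_mono a hi hxy)
        directedOn := fun φ hφ ψ hψ => ⟨or φ ψ, mem_of_le_or hφ hψ (opF_or_le a φ ψ hi),
          le_or_left φ ψ, le_or_right φ ψ⟩ }
  · exact
      { nonempty := ⟨top, J.2.mem_of_signedLE (J.bot_mem isBot_bot) (opF_top_le a hi)⟩
        mem_of_signedLE := fun hx hxy => J.2.mem_of_signedLE hx (opF_anti a hi hxy)
        directedOn := fun φ hφ ψ hψ => ⟨and φ ψ, mem_of_le_or hφ hψ (opF_and_le a φ ψ hi),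
          and_le_left φ ψ, and_le_right φ ψ⟩ }

theorem isNormalOp_opG (g : S.G) : IsNormalOp .del (S.ordG g) (opG (P := P) g) := by
  intro (J : SignedFilter (Formula S P) .one) a i
  have mem_of_and_le {χ φ ψ : Formula S P} (hφ : φ ∈ J) (hψ : ψ ∈ J) (hχ : and φ ψ ≤ χ) : χ ∈ J :=
    J.2.mem_of_signedLE ((J.mem_iff_of_isGLB (isGLB_and φ ψ)).2 ⟨hφ, hψ⟩) hχ
  cases hi : S.ordG g i
  · exact
      { nonempty := ⟨top, J.2.mem_of_signedLE (J.top_mem isTop_top) (le_opG_top a hi)⟩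
        mem_of_signedLE := fun hx hxy => J.2.mem_of_signedLE hx (opG_mono a hi hxy)
        directedOn := fun φ hφ ψ hψ => ⟨and φ ψ, mem_of_and_le hφ hψ (le_opG_and a φ ψ hi),
          and_le_left φ ψ, and_le_right φ ψ⟩ }
  · exact
      { nonempty := ⟨bot, J.2.mem_of_signedLE (J.top_mem isTop_top) (le_opG_bot a hi)⟩
        mem_of_signedLE := fun hx hxy => J.2.mem_of_signedLE hx (opG_anti a hi hxy)
        directedOn := fun φ hφ ψ hψ => ⟨or φ ψ, mem_of_and_le hφ hψ (le_opG_or a φ ψ hi),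
          le_or_left φ ψ, le_or_right φ ψ⟩ }

end Formula

section CanonicalAlgebra

open CanonicalExtension

variable (S : Signature.{u, v}) (P : Type w) [DecidableEq P] [Infinite P]

/-- The canonical extension of the formulas, with the extensions of the connectives. -/
def canonicalAlgebra : ResiduatedAlgebra S (CanonicalExtension (Formula S P)) where
  opF f := extension .one (S.ordF f) (Formula.opF f)
  opG g := extension .del (S.ordG g) (Formula.opG g)
  isResiduated_opF f := (Formula.isNormalOp_opF f).isResiduated_extension
  isResiduated_opG g := (Formula.isNormalOp_opG g).isResiduated_extension

variable {S P}

theorem canonicalAlgebra_eval_embed_var (φ : Formula S P) :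
    (canonicalAlgebra S P).eval (fun p => embed (.var p)) φ = embed φ := by
  induction φ with
  | var p => rfl
  | bot => exact (embed_eq_bot Formula.isBot_bot).symm
  | top => exact (embed_eq_top Formula.isTop_top).symm
  | and φ ψ hφ hψ =>
    exact (congrArg₂ (· ⊓ ·) hφ hψ).trans (embed_eq_inf (Formula.isGLB_and φ ψ)).symm
  | or φ ψ hφ hψ =>
    exact (congrArg₂ (· ⊔ ·) hφ hψ).trans (embed_eq_sup (Formula.isLUB_or φ ψ)).symm
  | opF f a ha =>
    exact (congrArg (extension _ _ _) (funext ha)).trans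
      ((Formula.isNormalOp_opF f).extension_embed a)
  | opG g a ha =>
    exact (congrArg (extension _ _ _) (funext ha)).trans
      ((Formula.isNormalOp_opG g).extension_embed a)

theorem mem_basicLogic_of_canonicalAlgebra_valid {s : Sequent S P}
    (hs : (canonicalAlgebra S P).Valid s) : s ∈ basicLogic S P := by
  have := hs fun p => embed (.var p)
  rwa [canonicalAlgebra_eval_embed_var, canonicalAlgebra_eval_embed_var, embed_le_embed] at this

end CanonicalAlgebra

/-! ### The inclusion of the basic logic in the tense logic -/

section Inclusion

variable {S : Signature.{u, v}} {P : Type w}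

namespace Formula

theorem toStar_subst (σ : P → Formula S P) (φ : Formula S P) :
    (φ.subst σ).toStar = φ.toStar.subst fun p => (σ p).toStar := by
  induction φ with
  | var p => rfl
  | bot => rfl
  | top => rfl
  | and φ ψ hφ hψ => exact congrArg₂ and hφ hψ
  | or φ ψ hφ hψ => exact congrArg₂ or hφ hψ
  | opF f a ha => exact congrArg (starF f) (funext ha)
  | opG g a ha => exact congrArg (starG g) (funext ha)

theorem toStar_subst1 [DecidableEq P] (φ χ : Formula S P) (p : P) :
    (φ.subst1 χ p).toStar = φ.toStar.subst1 χ.toStar p :=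
  (toStar_subst _ φ).trans <| congrArg (fun σ => φ.toStar.subst σ) <|
    funext fun q => apply_update (fun _ => toStar) _ p χ q

theorem toStar_atF (f : S.F) (a : Fin (S.arF f) → P) (i : Fin (S.arF f)) (φ : Formula S P) :
    (atF f a i φ).toStar = atF (S := S.star) (.base f) a i φ.toStar :=
  congrArg (starF f) (funext fun j => apply_update (fun _ => toStar) _ i φ j)

theorem toStar_atG (g : S.G) (a : Fin (S.arG g) → P) (i : Fin (S.arG g)) (φ : Formula S P) :
    (atG g a i φ).toStar = atG (S := S.star) (.base g) a i φ.toStar :=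
  congrArg (starG g) (funext fun j => apply_update (fun _ => toStar) _ i φ j)

end Formula

theorem toStar_mem_tenseLogic [DecidableEq P] {s : Sequent S P} (hs : s ∈ basicLogic S P) :
    s.toStar ∈ tenseLogic S P := by
  change Derivable S.star P _ _
  change Derivable S P _ _ at hs
  induction hs with
    (try simp only [Sequent.toStar, Formula.toStar_subst1, Formula.toStar_atF, Formula.toStar_atG,
      Formula.toStar])
  | refl p => exact .refl p
  | botLe p => exact .botLe p
  | leTop p => exact .leTop p
  | leOrLeft p q => exact .leOrLeft p q
  | leOrRight p q => exact .leOrRight p q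
  | andLeLeft p q => exact .andLeLeft p q
  | andLeRight p q => exact .andLeRight p q
  | fBot f a i hi => exact .fBot (S := S.star) (.base f) a i hi
  | fTop f a i hi => exact .fTop (S := S.star) (.base f) a i hi
  | gTop g a i hi => exact .gTop (S := S.star) (.base g) a i hi
  | gBot g a i hi => exact .gBot (S := S.star) (.base g) a i hi
  | fOr f a i p q hi => exact .fOr (S := S.star) (.base f) a i p q hi
  | fAnd f a i p q hi => exact .fAnd (S := S.star) (.base f) a i p q hi
  | gAnd g a i p q hi => exact .gAnd (S := S.star) (.base g) a i p q hi
  | gOr g a i p q hi => exact .gOr (S := S.star) (.base g) a i p q hi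
  | cut φ χ ψ _ _ hφχ hχψ => exact .cut _ _ _ hφχ hχψ
  | substitution φ ψ χ p _ h => exact .substitution _ _ _ p h
  | leAnd χ φ ψ _ _ hφ hψ => exact .leAnd _ _ _ hφ hψ
  | orLe φ ψ χ _ _ hφ hψ => exact .orLe _ _ _ hφ hψ
  | fMono f a i φ ψ hi _ h => exact .fMono (S := S.star) (.base f) a i _ _ hi h
  | fAnti f a i φ ψ hi _ h => exact .fAnti (S := S.star) (.base f) a i _ _ hi h
  | gMono g a i φ ψ hi _ h => exact .gMono (S := S.star) (.base g) a i _ _ hi h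
  | gAnti g a i φ ψ hi _ h => exact .gAnti (S := S.star) (.base g) a i _ _ hi h
  | extra _ _ hst _ _ => exact hst.elim

end Inclusion

end LELogic

theorem mainTheorem11_general (S : LELogic.Signature.{u, v}) (P : Type w) [DecidableEq P]
    [Infinite P] (s : LELogic.Sequent S P) :
    s ∈ LELogic.basicLogic S P ↔ s.toStar ∈ LELogic.tenseLogic S P :=
  ⟨LELogic.toStar_mem_tenseLogic, fun hs =>
    have valid := (LELogic.canonicalAlgebra S P).valid_of_toStar_mem_tenseLogic hs
    LELogic.mem_basicLogic_of_canonicalAlgebra_valid valid⟩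

/-- The basic tense logic is a conservative extension of the basic LE-logic, for every LE-signature
`S` and every denumerable set `P` of proposition letters. -/
theorem mainTheorem11 (S : LELogic.Signature.{u, v}) (P : Type w) [DecidableEq P] [Countable P]
    [Infinite P] (s : LELogic.Sequent S P) :
    s ∈ LELogic.basicLogic S P ↔ s.toStar ∈ LELogic.tenseLogic S P :=
  mainTheorem11_general S P s
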